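/- Fix a set $\mathcal{AP}$ of atomic propositions. Formulae of Metric Propositional Neighborhood Logic (MPNL) are given by $\varphi ::= \mathrm{len}_{<k} \mid p \mid \neg\varphi \mid \varphi\vee\varphi \mid \lozenge_l\varphi \mid \lozenge_r\varphi$ with $p\in\mathcal{AP}$, $k\in\mathbb{N}$; $|\varphi|$ is the number of symbols of $\varphi$, with each $k$ written in binary (parentheses are not counted). A finite model is a set $D=\{0,\dots,N-1\}$ with a set of intervals $[x,y]$ ($x\le y$ in $D$) for each $p\in\mathcal{AP}$; on $[x,y]$, the formula $\mathrm{len}_{<k}$ holds iff $y-x<k$, $\lozenge_l\psi$ holds iff $\psi$ holds on $[z,x]$ for some $z\le x$ in $D$, $\lozenge_r\psi$ holds iff $\psi$ holds on $[y,z]$ for some $z\ge y$ in $D$, and $p$, $\neg$, $\vee$ are read as usual. Let $Cl(\varphi)$ be the set of subformulae of $\varphi$ and of their negations, where the negation of $\neg\alpha$ is $\alpha$. A $\varphi$-atom is a non-empty $F\subseteq Cl(\varphi)$ such that for $\alpha\in Cl(\varphi)$, $\alpha\in F$ iff the negation of $\alpha$ is not in $F$; for $\alpha\vee\beta\in Cl(\varphi)$,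 $\alpha\vee\beta\in F$ iff $\alpha\in F$ or $\beta\in F$; and for $k<k'$ with $\mathrm{len}_{<k},\mathrm{len}_{<k'}\in Cl(\varphi)$, $\mathrm{len}_{<k}\in F$ implies $\mathrm{len}_{<k'}\in F$. For $s\in\{l,r\}$ put $Obs_s(F)=\{\psi\in F : \lozenge_s\psi\in Cl(\varphi)\}$ and $Req_s(F)=\{\psi\in Cl(\varphi) : \lozenge_s\psi\in F\}$. A finite compass $\varphi$-structure over $D=\{0,\dots,N-1\}$ assigns a $\varphi$-atom $\mathcal{L}(x,y)$ to each pair $x\le y$ in $D$ such that (i) $Obs_r(\mathcal{L}(y,z))\subseteq Req_r(\mathcal{L}(x,y))$ and $Obs_l(\mathcal{L}(x,y))\subseteq Req_l(\mathcal{L}(y,z))$ for all $x\le y\le z$ in $D$, and (ii) $\mathrm{len}_{<k}\in\mathcal{L}(x,y)$ implies $y-x<k$. It features $\psi$ if $\psi\in\mathcal{L}(x,y)$ for some $x\le y$ in $D$. It is fulfilling if for all $x\le y$ in $D$, every $\psi\in Req_r(\mathcal{L}(x,y))$ lies in $\mathcal{L}(y,z)$ for some $z\ge y$ in $D$ and every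 $\psi\in Req_l(\mathcal{L}(x,y))$ lies in $\mathcal{L}(z,x)$ for some $z\le x$ in $D$. Theorem. Let $\varphi$ be an MPNL formula and $B(\varphi)=\left(\frac{|\varphi|^2}{4}+\frac{|\varphi|}{2}+1\right)^{2^{3|\varphi|}}$. (1) If there is a finite fulfilling compass $\varphi$-structure featuring $\varphi$, then there is one, over a domain $D'$, with $|D'|\le B(\varphi)$. (2) If $\varphi$ holds on some interval of some finite model, then it holds on some interval of a finite model whose domain has at most $B(\varphi)$ points. -/

import Mathlib

namespace MPNL

/-- Formulae of Metric Propositional Neighborhood Logic over the set `AP` of atomic propositions: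
`len k` is the length constraint `len_{<k}`, `diaL` and `diaR` are the modalities
`◇_l` (met by) and `◇_r` (meets). -/
inductive Formula (AP : Type*) where
  | len (k : ℕ) : Formula AP
  | prop (p : AP) : Formula AP
  | neg (α : Formula AP) : Formula AP
  | or (α β : Formula AP) : Formula AP
  | diaL (α : Formula AP) : Formula AP
  | diaR (α : Formula AP) : Formula AP

namespace Formula

variable {AP : Type*}

/-- Number of digits of the binary numeral of `k` (the numeral `0` has one digit). -/
def binaryDigits (k : ℕ) : ℕ := max 1 (Nat.size k)

/-- The length `|φ|`: the number of symbols of `φ`, length constraints being written in binary. -/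
def length : Formula AP → ℕ
  | len k => 1 + binaryDigits k
  | prop _ => 1
  | neg α => 1 + length α
  | or α β => 1 + length α + length β
  | diaL α => 1 + length α
  | diaR α => 1 + length α

/-- The set of all subformulae of a formula, itself included. -/
def subformulas : Formula AP → Set (Formula AP)
  | len k => {len k}
  | prop p => {prop p}
  | neg α => {neg α} ∪ subformulas α
  | or α β => {or α β} ∪ subformulas α ∪ subformulas β
  | diaL α => {diaL α} ∪ subformulas α
  | diaR α => {diaR α} ∪ subformulas α

/-- Negation with `¬¬α` identified with `α`: the negation of `¬α` is `α`. -/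
def compl : Formula AP → Formula AP
  | neg α => α
  | α => neg α

/-- The closure `Cl(φ)`: all subformulae of `φ` and their negations. -/
def closure (φ : Formula AP) : Set (Formula AP) :=
  subformulas φ ∪ compl '' subformulas φ

/-- The set `K_φ` of the metric parameters of `φ`. -/
def params (φ : Formula AP) : Set ℕ := {k | len k ∈ closure φ}

end Formula

/-- `M, [x, y] ⊩ φ` in the model `M = ⟨D, V⟩` with `D = {0, …, N - 1}`; it is meant for
intervals `x ≤ y < N`, where the distance of `x` and `y` is `y - x`. Only the values
of `V` at intervals of `D` matter. -/
def Holds {AP : Type*} (N : ℕ) (V : AP → ℕ → ℕ → Prop) : ℕ → ℕ → Formula AP → Prop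
  | x, y, .len k => y - x < k
  | x, y, .prop p => V p x y
  | x, y, .neg α => ¬ Holds N V x y α
  | x, y, .or α β => Holds N V x y α ∨ Holds N V x y β
  | x, _, .diaL α => ∃ z, z ≤ x ∧ Holds N V z x α
  | _, y, .diaR α => ∃ z, y ≤ z ∧ z < N ∧ Holds N V y z α

/-- `φ` is satisfiable over the finite linear order `{0, …, N - 1}`. -/
def SatisfiableOn {AP : Type*} (N : ℕ) (φ : Formula AP) : Prop :=
  ∃ V : AP → ℕ → ℕ → Prop, ∃ x y : ℕ, x ≤ y ∧ y < N ∧ Holds N V x y φ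

/-- `F` is a `φ`-atom. -/
structure IsAtom {AP : Type*} (φ : Formula AP) (F : Set (Formula AP)) : Prop where
  nonempty : F.Nonempty
  subset : F ⊆ Formula.closure φ
  neg_iff : ∀ α ∈ Formula.closure φ, (α ∈ F ↔ Formula.compl α ∉ F)
  or_iff : ∀ α β : Formula AP, Formula.or α β ∈ Formula.closure φ →
    (Formula.or α β ∈ F ↔ α ∈ F ∨ β ∈ F)
  len_mono : ∀ k ∈ Formula.params φ, ∀ k' ∈ Formula.params φ, k < k' →
    Formula.len k ∈ F → Formula.len k' ∈ F

/-- Future observable formulae of `F`. -/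
def obsR {AP : Type*} (φ : Formula AP) (F : Set (Formula AP)) : Set (Formula AP) :=
  {ψ | ψ ∈ F ∧ Formula.diaR ψ ∈ Formula.closure φ}

/-- Past observable formulae of `F`. -/
def obsL {AP : Type*} (φ : Formula AP) (F : Set (Formula AP)) : Set (Formula AP) :=
  {ψ | ψ ∈ F ∧ Formula.diaL ψ ∈ Formula.closure φ}

/-- The `◇_r`-requests of `F`. -/
def reqR {AP : Type*} (φ : Formula AP) (F : Set (Formula AP)) : Set (Formula AP) :=
  {ψ | ψ ∈ Formula.closure φ ∧ Formula.diaR ψ ∈ F}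

/-- The `◇_l`-requests of `F`. -/
def reqL {AP : Type*} (φ : Formula AP) (F : Set (Formula AP)) : Set (Formula AP) :=
  {ψ | ψ ∈ Formula.closure φ ∧ Formula.diaL ψ ∈ F}

/-- The relation `F →_R G` between atoms. -/
def DepR {AP : Type*} (φ : Formula AP) (F G : Set (Formula AP)) : Prop :=
  obsR φ G ⊆ reqR φ F ∧ obsL φ F ⊆ reqL φ G

/-- `L` is the labelling of a compass `φ`-structure over the finite domain `D = {0, …, N - 1}`,
whose points are the pairs `(x, y)` with `x ≤ y < N`. The values of `L` elsewhere are irrelevant. -/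
structure IsCompassStructure {AP : Type*} (φ : Formula AP) (N : ℕ)
    (L : ℕ → ℕ → Set (Formula AP)) : Prop where
  atom : ∀ x y, x ≤ y → y < N → IsAtom φ (L x y)
  temporal_consistency : ∀ x y x' y', x ≤ y → y < N → x' ≤ y' → y' < N → y = x' →
    DepR φ (L x y) (L x' y')
  length_consistency : ∀ x y, x ≤ y → y < N → ∀ k, Formula.len k ∈ L x y → y - x < k

/-- The structure over `{0, …, N - 1}` with labelling `L` features `ψ`. -/
def Features {AP : Type*} (N : ℕ) (L : ℕ → ℕ → Set (Formula AP)) (ψ : Formula AP) : Prop :=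
  ∃ x y, x ≤ y ∧ y < N ∧ ψ ∈ L x y

/-- The compass `φ`-structure over `{0, …, N - 1}` with labelling `L` is fulfilling. -/
def IsFulfilling {AP : Type*} (φ : Formula AP) (N : ℕ) (L : ℕ → ℕ → Set (Formula AP)) : Prop :=
  ∀ x y, x ≤ y → y < N →
    (∀ ψ ∈ reqR φ (L x y), ∃ x' y', x' ≤ y' ∧ y' < N ∧ x' = y ∧ ψ ∈ L x' y') ∧
    (∀ ψ ∈ reqL φ (L x y), ∃ x' y', x' ≤ y' ∧ y' < N ∧ y' = x ∧ ψ ∈ L x' y')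

/-- There is a fulfilling compass `φ`-structure featuring `φ` over a domain with `N` points. -/
def HasFulfillingCompass {AP : Type*} (φ : Formula AP) (N : ℕ) : Prop :=
  ∃ L : ℕ → ℕ → Set (Formula AP),
    IsCompassStructure φ N L ∧ IsFulfilling φ N L ∧ Features N L φ

end MPNL

/-! The proof is a pumping argument. In a fulfilling structure the modal formulae of a label are
fixed by what the end points of its interval observe to their left and right; `IsIntervalStructure`
keeps only the labels and these observations. Seen from row y (the intervals ending at y), a point x
has a type: its two observation sets, and the part of the right one already met up to y. No
constraint len_{<k} of φ can hold at a length of at least K = 2^(|φ|-1). So the state of a row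
records the types of its K nearest points exactly and, for each type, the number of farther points,
cut off at some M. If two rows have the same state, the points between them can be deleted: in later
rows, each point up to the lower row borrows labels from points of its own type in the upper row
(`contract_of_rowState_eq`).

The crux is that borrowing loses no observation (`exists_redirection`). If the numbers of far points
of a type agree, a bijection suffices. Otherwise both reach the cut-off, and the source of the
labels may change from row to row: for each pair of a set of pending right observations and a single
left observation, one track of sources serves all occurrences of that pair and still meets all its
own obligations (`exists_track`). The number of such pairs is the cut-off M.

There are at most 2^2^(3|φ|-1) states, so longer structures shrink, and B(φ) exceeds this number.
Compass structures and models differ only in their length condition, so both claims are instances of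
`HasGoodCompass.exists_small`. -/

namespace MPNL

/-! ### Serving all demands by few points -/

/-- The elements of `p` that `x` has not met in the rows of `Y` below `y`. -/
def pending {β : Type*} (Y : Finset ℕ) (p : Set β) (a : ℕ → ℕ → Set β) (x y : ℕ) : Set β :=
  {ψ | ψ ∈ p ∧ ∀ z ∈ Y, z < y → ψ ∉ a x z}

/-- A single track through the rows of `Y` that meets all of `p` and serves every occurrence of the
demand `i` witnessed by an element whose pending set is `q`. -/
lemma exists_track {α β : Type*} (X Y : Finset ℕ) (p q : Set β) (i : α)
    (a : ℕ → ℕ → Set β) (D : ℕ → ℕ → Set α) (hX : X.Nonempty)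
    (ha : ∀ x ∈ X, ∀ ψ ∈ p, ∃ y ∈ Y, ψ ∈ a x y) :
    ∃ k : ℕ → ℕ, (∀ y, k y ∈ X) ∧
      (∀ y ∈ Y, (∃ x ∈ X, i ∈ D x y ∧ pending Y p a x y = q) → i ∈ D (k y) y) ∧
      ∀ ψ ∈ p, ∃ y ∈ Y, ψ ∈ a (k y) y := by
  classical
  let Q : ℕ → Prop := fun y => ∃ x ∈ X, i ∈ D x y ∧ pending Y p a x y = q
  by_cases hne : (Y.filter Q).Nonempty
  · have hw : ∀ y, ∃ x, Q y → x ∈ X ∧ i ∈ D x y ∧ pending Y p a x y = q := by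
      intro y
      by_cases h : Q y
      · obtain ⟨x, hx⟩ := h
        exact ⟨x, fun _ => hx⟩
      · exact ⟨0, fun h' => absurd h' h⟩
    choose w hw using hw
    obtain ⟨u, hu, hu_min⟩ := (Y.filter Q).exists_minimal hne
    obtain ⟨v, hv, hv_max⟩ := (Y.filter Q).exists_maximal hne
    have hu' := Finset.mem_filter.1 hu
    have hv' := Finset.mem_filter.1 hv
    have hlow : ∀ y ∈ Y, Q y → u ≤ y := fun y hy hq => by
      by_contra hlt
      exact hlt (hu_min (Finset.mem_filter.2 ⟨hy, hq⟩) (by omega))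
    have hupp : ∀ y ∈ Y, Q y → y ≤ v := fun y hy hq => by
      by_contra hlt
      exact hlt (hv_max (Finset.mem_filter.2 ⟨hy, hq⟩) (by omega))
    have huv : u ≤ v := hlow v hv'.1 hv'.2
    -- Here `u` and `v` are the first and last rows with the demand. Below `u` the track follows `w
    -- u`, which has met everything outside `q` by then; from `v` on it follows `w v`, which has all
    -- of `q` still to meet. In between it may switch freely, so it serves each demand as it comes.
    refine ⟨fun y => if y < u then w u else if v ≤ y then w v else if Q y then w y else w u,
      ?_, ?_, ?_⟩
    · intro y
      dsimp only
      split_ifs with h1 h2 h3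
      · exact (hw u hu'.2).1
      · exact (hw v hv'.2).1
      · exact (hw y h3).1
      · exact (hw u hu'.2).1
    · intro y hy hq
      have h1 : ¬ y < u := not_lt.2 (hlow y hy hq)
      have h2 := hupp y hy hq
      dsimp only
      rw [if_neg h1]
      split_ifs with h3
      · obtain rfl : y = v := by omega
        exact (hw y hq).2.1
      · exact (hw y hq).2.1
    · intro ψ hψ
      by_cases hq : ψ ∈ q
      · obtain ⟨h1, -, h3⟩ := hw v hv'.2
        obtain ⟨y, hy, hya⟩ := ha _ h1 ψ hψ
        rw [← h3] at hq
        have hvy : v ≤ y := by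
          by_contra hlt
          exact hq.2 y hy (by omega) hya
        refine ⟨y, hy, ?_⟩
        dsimp only
        rwa [if_neg (by omega), if_pos hvy]
      · obtain ⟨h1, -, h3⟩ := hw u hu'.2
        rw [← h3] at hq
        have : ∃ z ∈ Y, z < u ∧ ψ ∈ a (w u) z := by
          by_contra hcon
          push Not at hcon
          exact hq ⟨hψ, hcon⟩
        obtain ⟨z, hz, hzu, hza⟩ := this
        exact ⟨z, hz, by simpa only [if_pos hzu] using hza⟩
  · obtain ⟨x, hx⟩ := hX
    -- The demand never occurs, so any constant track works.
    refine ⟨fun _ => x, fun _ => hx, fun y hy hq => ?_, ha x hx⟩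
    exact absurd ⟨y, Finset.mem_filter.2 ⟨hy, hq⟩⟩ hne

/-- The elements of `X'` can take over the roles of those of `X` in all rows of `Y`, provided that
the two sets have the same size or `X'` is large. -/
lemma exists_redirection {α β : Type*} [Fintype α] [Nonempty α] [Fintype β]
    (X X' Y : Finset ℕ) (p : Set β)
    (a : ℕ → ℕ → Set β) (D : ℕ → ℕ → Set α)
    (ha : ∀ x ∈ X, ∀ ψ ∈ p, ∃ y ∈ Y, ψ ∈ a x y)
    (hcard : X'.card = X.card ∨
      (X.Nonempty ∧ 2 ^ Fintype.card β * Fintype.card α ≤ X'.card)) :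
    ∃ h : ℕ → ℕ → ℕ, (∀ y, ∀ x ∈ X', h y x ∈ X) ∧
      (∀ y ∈ Y, ∀ x ∈ X, ∀ i ∈ D x y, ∃ x' ∈ X', i ∈ D (h y x') y) ∧
      ∀ x ∈ X', ∀ ψ ∈ p, ∃ y ∈ Y, ψ ∈ a (h y x) y := by
  classical
  rcases hcard with hcard | ⟨hX, hcard⟩
  · let e := Finset.equivOfCardEq hcard
    refine ⟨fun _ x => if hx : x ∈ X' then e ⟨x, hx⟩ else 0, ?_, ?_, ?_⟩
    · intro y x hx
      simp only [dif_pos hx]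
      exact (e ⟨x, hx⟩).2
    · intro y _ x hx i hi
      refine ⟨e.symm ⟨x, hx⟩, (e.symm ⟨x, hx⟩).2, ?_⟩
      simpa using hi
    · intro x hx ψ hψ
      simp only [dif_pos hx]
      exact ha _ (e ⟨x, hx⟩).2 ψ hψ
  -- Each pair of a pending set and a demand is a role; `X'` is large enough for every role to be
  -- played by a point of its own, and the remaining points follow tracks as well.
  · have hcard' : Fintype.card (Set β × α) ≤ Fintype.card X' := by
      simpa [Fintype.card_prod, Fintype.card_set] using hcard
    obtain ⟨f⟩ := Function.Embedding.nonempty_of_card_le hcard'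
    have hk := fun r : Set β × α => exists_track X Y p r.1 r.2 a D hX ha
    choose k hk1 hk2 hk3 using hk
    let role : ℕ → Set β × α := fun x => if hx : x ∈ X' then Function.invFun f ⟨x, hx⟩
      else Classical.arbitrary _
    refine ⟨fun y x => k (role x) y, fun y x _ => hk1 _ y, ?_, fun x _ => hk3 _⟩
    intro y hy x hx i hi
    refine ⟨f (pending Y p a x y, i), (f _).2, ?_⟩
    have hrole : role (f (pending Y p a x y, i)) = (pending Y p a x y, i) := by
      simp only [role, Subtype.coe_eta, dif_pos (f _).2]
      exact Function.leftInverse_invFun f.injective _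
    dsimp only
    rw [hrole]
    exact hk2 (pending Y p a x y, i) y hy ⟨x, hx, hi, rfl⟩


/-! ### Interval structures and removal of points -/

/-- A labelling of the intervals of `{0, …, N - 1}` in which the point `x` observes exactly `tl x` in
the labels of the intervals ending at `x` and exactly `tr x` in those of the intervals starting at `x`;
`ok` says which labels are allowed on an interval, given the observations at its end points and its
length. -/
structure IsIntervalStructure {α β A : Type*} (oL : A → Set α) (oR : A → Set β)
    (ok : Set α → Set β → A → ℕ → Prop) (N : ℕ) (L : ℕ → ℕ → A) (tl : ℕ → Set α)
    (tr : ℕ → Set β) : Prop where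
  ok : ∀ x y, x ≤ y → y < N → ok (tl x) (tr y) (L x y) (y - x)
  left : ∀ y < N, ∀ ψ, ψ ∈ tl y ↔ ∃ x ≤ y, ψ ∈ oL (L x y)
  right : ∀ x < N, ∀ ψ, ψ ∈ tr x ↔ ∃ y, x ≤ y ∧ y < N ∧ ψ ∈ oR (L x y)

section

variable {α β A : Type*} {oL : A → Set α} {oR : A → Set β}
  {ok : Set α → Set β → A → ℕ → Prop} {N : ℕ} {L : ℕ → ℕ → A} {tl : ℕ → Set α} {tr : ℕ → Set β}

/-- What `x` observes in the intervals from `x` to the points up to `y`. -/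
def seen (oR : A → Set β) (L : ℕ → ℕ → A) (x y : ℕ) : Set β :=
  {ψ | ∃ z, x ≤ z ∧ z ≤ y ∧ ψ ∈ oR (L x z)}

/-- The points of an interval structure from which `s` points following `c` are removed. -/
def skip (c s i : ℕ) : ℕ := if i ≤ c then i else i + s

/-- Removal of the points `c + 1, …, c + s`, the points up to `c` being redirected by `h` in the
later rows. -/
lemma IsIntervalStructure.contract (H : IsIntervalStructure oL oR ok N L tl tr) {K : ℕ}
    (hK : ∀ l r b d d', K ≤ d → K ≤ d' → ok l r b d → ok l r b d') (c s : ℕ) (hcs : c + s < N)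
    (h : ℕ → ℕ → ℕ)
    (h_le : ∀ y x, x ≤ c → h y x ≤ c + s)
    (h_tl : ∀ y x, x ≤ c → tl (h y x) = tl x)
    (h_tr : ∀ y x, x ≤ c → tr (h y x) = tr x)
    (h_dist : ∀ y x, x ≤ c → h y x = x + s ∨ (h y x + K ≤ c + s ∧ x + K ≤ c))
    (h_left : ∀ y, c + s < y → y < N → ∀ x ≤ c + s, ∀ ψ ∈ oL (L x y),
      ∃ x' ≤ c, ψ ∈ oL (L (h y x') y))
    (h_right : ∀ x ≤ c, ∀ ψ ∈ tr x, ψ ∉ seen oR L x c →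
      ∃ y, c + s < y ∧ y < N ∧ ψ ∈ oR (L (h y x) y)) :
    ∃ L' : ℕ → ℕ → A,
      IsIntervalStructure oL oR ok (N - s) L' (tl ∘ skip c s) (tr ∘ skip c s) := by
  -- Rows up to `c` are untouched. A later row `y` copies the old row `y + s`, with the starting
  -- points up to `c` redirected.
  refine ⟨fun x y => if y ≤ c then L x y
    else if x ≤ c then L (h (y + s) x) (y + s) else L (x + s) (y + s), ?_, ?_, ?_⟩
  · intro x y hxy hy
    by_cases hyc : y ≤ c
    · have hxc : x ≤ c := hxy.trans hyc
      simp only [skip, Function.comp, hyc, hxc, if_true]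
      exact H.ok x y hxy (by omega)
    · by_cases hxc : x ≤ c
      · simp only [skip, Function.comp, hyc, hxc, if_true, if_false]
        have h1 := h_le (y + s) x hxc
        have h2 := H.ok (h (y + s) x) (y + s) (by omega) (by omega)
        rw [h_tl _ _ hxc] at h2
        -- Either the copied interval has the same length as the new one, or both have length at
        -- least `K`, where `ok` does not depend on the length.
        rcases h_dist (y + s) x hxc with h3 | h3
        · rwa [h3, Nat.add_sub_add_right, ← h3] at h2
        · exact hK _ _ _ _ _ (by omega) (by omega) h2
      · simp only [skip, Function.comp, hyc, hxc, if_false]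
        have h2 := H.ok (x + s) (y + s) (by omega) (by omega)
        rwa [Nat.add_sub_add_right] at h2
  · intro y hy ψ
    by_cases hyc : y ≤ c
    · simp only [skip, Function.comp, hyc, if_true]
      exact H.left y (by omega) ψ
    · simp only [skip, Function.comp, hyc, if_false]
      rw [H.left (y + s) (by omega)]
      constructor
      · rintro ⟨x, hx, hψ⟩
        by_cases hxc : x ≤ c + s
        · obtain ⟨x', hx', hψ'⟩ := h_left (y + s) (by omega) (by omega) x hxc ψ hψ
          exact ⟨x', by omega, by rwa [if_pos hx']⟩
        · refine ⟨x - s, by omega, ?_⟩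
          rw [if_neg (by omega), Nat.sub_add_cancel (by omega)]
          exact hψ
      · rintro ⟨x, hx, hψ⟩
        split_ifs at hψ with hxc
        · have := h_le (y + s) x hxc
          exact ⟨_, by omega, hψ⟩
        · exact ⟨_, by omega, hψ⟩
  · intro x hx ψ
    by_cases hxc : x ≤ c
    · simp only [skip, Function.comp, hxc, if_true]
      constructor
      · intro hψ
        by_cases hs : ψ ∈ seen oR L x c
        · obtain ⟨z, h1, h2, h3⟩ := hs
          exact ⟨z, h1, by omega, by rwa [if_pos h2]⟩
        · obtain ⟨y, h1, h2, h3⟩ := h_right x hxc ψ hψ hs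
          refine ⟨y - s, by omega, by omega, ?_⟩
          rw [if_neg (by omega), Nat.sub_add_cancel (by omega)]
          exact h3
      · rintro ⟨y, hxy, hy, hψ⟩
        split_ifs at hψ with hyc
        · exact (H.right x (by omega) ψ).2 ⟨y, hxy, by omega, hψ⟩
        · have := h_le (y + s) x hxc
          -- Nothing new is observed: the label comes from a point with the same right observations.
          rw [← h_tr (y + s) x hxc]
          exact (H.right _ (by omega) ψ).2 ⟨y + s, by omega, by omega, hψ⟩
    · simp only [skip, Function.comp, hxc, if_false]
      rw [H.right (x + s) (by omega)]
      constructor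
      · rintro ⟨y, h1, h2, h3⟩
        refine ⟨y - s, by omega, by omega, ?_⟩
        rw [if_neg (by omega), Nat.sub_add_cancel (by omega)]
        exact h3
      · rintro ⟨y, h1, h2, h3⟩
        rw [if_neg (by omega)] at h3
        exact ⟨y + s, by omega, by omega, h3⟩

/-! ### Row states and contraction between rows with equal states -/

/-- The type of the point `x` as seen from row `y`. -/
def pointType (oR : A → Set β) (L : ℕ → ℕ → A) (tl : ℕ → Set α) (tr : ℕ → Set β) (x y : ℕ) :
    Set α × Set β × Set β :=
  (tl x, tr x, seen oR L x y)

open Classical in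
/-- The points of type `t` at distance at least `K` from row `y`. -/
noncomputable def farPoints (K : ℕ) (oR : A → Set β) (L : ℕ → ℕ → A) (tl : ℕ → Set α)
    (tr : ℕ → Set β) (y : ℕ) (t : Set α × Set β × Set β) : Finset ℕ :=
  (Finset.range (y + 1)).filter fun x => x + K ≤ y ∧ pointType oR L tl tr x y = t

lemma mem_farPoints {K y x : ℕ} {t : Set α × Set β × Set β} :
    x ∈ farPoints K oR L tl tr y t ↔ x + K ≤ y ∧ pointType oR L tl tr x y = t := by
  simp only [farPoints, Finset.mem_filter, Finset.mem_range]
  constructor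
  · exact fun h => h.2
  · exact fun h => ⟨by omega, h⟩

/-- The state of row `y`: the types of the points near `y`, and the numbers, up to `M`, of the points
of each type far from `y`. -/
noncomputable def rowState (K M : ℕ) (oR : A → Set β) (L : ℕ → ℕ → A) (tl : ℕ → Set α)
    (tr : ℕ → Set β) (y : ℕ) :
    (Fin K → Option (Set α × Set β × Set β)) × (Set α × Set β × Set β → Fin (M + 1)) :=
  (fun i => if (i : ℕ) ≤ y then some (pointType oR L tl tr (y - i) y) else none,
    fun t => ⟨min M (farPoints K oR L tl tr y t).card, by omega⟩)

lemma near_of_rowState_eq {K M c d : ℕ}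
    (h : rowState K M oR L tl tr c = rowState K M oR L tl tr d) {i : ℕ} (hi : i < K) :
    (i ≤ c ↔ i ≤ d) ∧
      (i ≤ c → pointType oR L tl tr (c - i) c = pointType oR L tl tr (d - i) d) := by
  have h1 := congrFun (congrArg Prod.fst h) ⟨i, hi⟩
  simp only [rowState] at h1
  split_ifs at h1 with h2 h3 h3
  · exact ⟨by simp [h2, h3], fun _ => Option.some.inj h1⟩
  · exact ⟨by simp [h2, h3], fun h4 => absurd h4 h2⟩

/-- The counts are compared after truncation at `M`: either both are below `M` and equal, or both
are at least `M`, hence positive. -/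
lemma far_of_rowState_eq {K M c d : ℕ}
    (h : rowState K M oR L tl tr c = rowState K M oR L tl tr d) (hM : 0 < M)
    (t : Set α × Set β × Set β) :
    (farPoints K oR L tl tr c t).card = (farPoints K oR L tl tr d t).card ∨
      ((farPoints K oR L tl tr d t).Nonempty ∧ M ≤ (farPoints K oR L tl tr c t).card) := by
  have h1 := congrArg Fin.val (congrFun (congrArg Prod.snd h) t)
  simp only [rowState] at h1
  rw [← Finset.card_pos]
  omega

/-- Two rows with the same state show the same types of points. -/
lemma exists_pointType_eq {K M c d : ℕ}
    (h : rowState K M oR L tl tr c = rowState K M oR L tl tr d) (hM : 0 < M) {x : ℕ} (hx : x ≤ d) :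
    ∃ x' ≤ c, pointType oR L tl tr x' c = pointType oR L tl tr x d := by
  by_cases hK : x + K ≤ d
  · have h1 : x ∈ farPoints K oR L tl tr d (pointType oR L tl tr x d) := mem_farPoints.2 ⟨hK, rfl⟩
    have h2 : (farPoints K oR L tl tr c (pointType oR L tl tr x d)).Nonempty := by
      have := Finset.card_pos.2 ⟨x, h1⟩
      rw [← Finset.card_pos]
      rcases far_of_rowState_eq h hM (pointType oR L tl tr x d) with h3 | h3 <;> omega
    obtain ⟨x', hx'⟩ := h2
    have h3 := mem_farPoints.1 hx'
    exact ⟨x', by omega, h3.2⟩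
  · obtain ⟨h1, h2⟩ := near_of_rowState_eq h (i := d - x) (by omega)
    have h3 : d - x ≤ c := h1.2 (by omega)
    refine ⟨c - (d - x), by omega, ?_⟩
    rw [h2 h3]
    congr 1
    omega

/-- The points between two rows with the same state can be removed. -/
lemma IsIntervalStructure.contract_of_rowState_eq [Fintype α] [Nonempty α] [Fintype β]
    (H : IsIntervalStructure oL oR ok N L tl tr) {K : ℕ}
    (hK : ∀ l r b d d', K ≤ d → K ≤ d' → ok l r b d → ok l r b d') {c s : ℕ} (hcs : c + s < N)
    (hst : rowState K (2 ^ Fintype.card β * Fintype.card α) oR L tl tr c =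
      rowState K (2 ^ Fintype.card β * Fintype.card α) oR L tl tr (c + s)) :
    ∃ L' : ℕ → ℕ → A,
      IsIntervalStructure oL oR ok (N - s) L' (tl ∘ skip c s) (tr ∘ skip c s) := by
  have hM : 0 < 2 ^ Fintype.card β * Fintype.card α :=
    Nat.mul_pos (by positivity) Fintype.card_pos
  -- The obligations `p` are the right observations still unmet at row `c + s`; the demands in a row
  -- are the left observations that its end point makes through the far points.
  have hred := fun t : Set α × Set β × Set β =>
    exists_redirection (farPoints K oR L tl tr (c + s) t) (farPoints K oR L tl tr c t)
      (Finset.Ioo (c + s) N) (t.2.1 \ t.2.2) (fun x y => oR (L x y)) (fun x y => oL (L x y))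
      (by
        rintro x hx ψ ⟨hψ, hψ'⟩
        obtain ⟨h1, rfl⟩ := mem_farPoints.1 hx
        obtain ⟨y, hy1, hy2, hy3⟩ := (H.right x (by omega) ψ).1 hψ
        refine ⟨y, Finset.mem_Ioo.2 ⟨?_, hy2⟩, hy3⟩
        by_contra hy
        exact hψ' ⟨y, hy1, by omega, hy3⟩)
      (far_of_rowState_eq hst hM t)
  choose g hg1 hg2 hg3 using hred
  let h : ℕ → ℕ → ℕ := fun y x =>
    if x + K ≤ c then g (pointType oR L tl tr x c) y x else x + s
  have h_far : ∀ y x, x + K ≤ c → h y x ∈ farPoints K oR L tl tr (c + s)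
      (pointType oR L tl tr x c) := by
    intro y x hx
    simp only [h, if_pos hx]
    exact hg1 _ y x (mem_farPoints.2 ⟨hx, rfl⟩)
  have h_near : ∀ y x, ¬ x + K ≤ c → h y x = x + s := fun y x hx => if_neg hx
  have h_type : ∀ y x, x ≤ c → pointType oR L tl tr (h y x) (c + s) = pointType oR L tl tr x c := by
    intro y x hx
    by_cases hxK : x + K ≤ c
    · exact (mem_farPoints.1 (h_far y x hxK)).2
    · rw [h_near y x hxK]
      have h1 := (near_of_rowState_eq hst (i := c - x) (by omega)).2 (by omega)
      rw [show c - (c - x) = x by omega, show c + s - (c - x) = x + s by omega] at h1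
      exact h1.symm
  refine H.contract hK c s hcs h ?_ ?_ ?_ ?_ ?_ ?_
  · intro y x hx
    by_cases hxK : x + K ≤ c
    · have := (mem_farPoints.1 (h_far y x hxK)).1
      omega
    · rw [h_near y x hxK]
      omega
  · exact fun y x hx => congrArg Prod.fst (h_type y x hx)
  · exact fun y x hx => congrArg (fun t => t.2.1) (h_type y x hx)
  · intro y x hx
    by_cases hxK : x + K ≤ c
    · exact Or.inr ⟨(mem_farPoints.1 (h_far y x hxK)).1, hxK⟩
    · exact Or.inl (h_near y x hxK)
  · intro y hy hyN x hx ψ hψ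
    by_cases hxK : x + K ≤ c + s
    · obtain ⟨x', hx', hψ'⟩ := hg2 (pointType oR L tl tr x (c + s)) y
        (Finset.mem_Ioo.2 ⟨hy, hyN⟩) x (mem_farPoints.2 ⟨hxK, rfl⟩) ψ hψ
      obtain ⟨h1, h2⟩ := mem_farPoints.1 hx'
      refine ⟨x', by omega, ?_⟩
      simp only [h, if_pos h1, h2]
      exact hψ'
    -- A near point of row `c + s` is the shift by `s` of a near point of row `c`, which is
    -- redirected back to it.
    · have h1 := (near_of_rowState_eq hst (i := c + s - x) (by omega)).1.2 (by omega)
      refine ⟨x - s, by omega, ?_⟩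
      rw [h_near _ _ (by omega), Nat.sub_add_cancel (by omega)]
      exact hψ
  · intro x hx ψ hψ hns
    by_cases hxK : x + K ≤ c
    · obtain ⟨y, hy, hψ'⟩ := hg3 (pointType oR L tl tr x c) x (mem_farPoints.2 ⟨hxK, rfl⟩) ψ
        ⟨hψ, hns⟩
      have := Finset.mem_Ioo.1 hy
      refine ⟨y, this.1, this.2, ?_⟩
      simp only [h, if_pos hxK]
      exact hψ'
    -- The row `0` is arbitrary: near points are redirected in the same way in all rows.
    · have h1 := h_type 0 x hx
      rw [h_near 0 x hxK] at h1
      have h2 : tr (x + s) = tr x := congrArg (fun t => t.2.1) h1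
      have h3 : seen oR L (x + s) (c + s) = seen oR L x c := congrArg (fun t => t.2.2) h1
      rw [← h2] at hψ
      rw [← h3] at hns
      obtain ⟨y, hy1, hy2, hy3⟩ := (H.right (x + s) (by omega) ψ).1 hψ
      have hy : c + s < y := by
        by_contra hy
        exact hns ⟨y, hy1, by omega, hy3⟩
      exact ⟨y, hy, hy2, by rwa [h_near _ _ hxK]⟩

/-! ### Counting row states and the small model property -/

/-- An upper bound on the number of row states. -/
lemma card_rowStates (α β : Type*) [Fintype α] [Fintype β] [Nonempty α] {K n : ℕ}
    (hn : Fintype.card α + Fintype.card β ≤ n) (hK : K ≤ 2 ^ (n - 1)) :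
    Nat.card ((Fin K → Option (Set α × Set β × Set β)) ×
      (Set α × Set β × Set β → Fin (2 ^ Fintype.card β * Fintype.card α + 1))) ≤
      2 ^ 2 ^ (3 * n - 1) := by
  classical
  obtain ⟨m, rfl⟩ : ∃ m, n = m + 1 := ⟨n - 1, by have := Fintype.card_pos (α := α); omega⟩
  have ha := Fintype.card_pos (α := α)
  simp only [Nat.card_eq_fintype_card, Fintype.card_prod, Fintype.card_fun, Fintype.card_option,
    Fintype.card_set, Fintype.card_fin]
  generalize Fintype.card α = a at *
  generalize Fintype.card β = b at *
  simp only [Nat.add_sub_cancel] at hK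
  -- Since `a ≥ 1`, the exponent `a + 2b = 2(a + b) - a` is at most `2(m + 1) - 1`.
  have hT : 2 ^ a * (2 ^ b * 2 ^ b) ≤ 2 ^ (2 * m + 1) := by
    rw [← pow_add, ← pow_add]
    exact Nat.pow_le_pow_right (by norm_num) (by omega)
  have hT1 : 2 ^ a * (2 ^ b * 2 ^ b) + 1 ≤ 2 ^ (2 * (m + 1)) := by
    have : 0 < 2 ^ (2 * m + 1) := by positivity
    have : 2 ^ (2 * (m + 1)) = 2 * 2 ^ (2 * m + 1) := by ring
    omega
  have hM : 2 ^ b * a + 1 ≤ 2 ^ (m + 1) := by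
    have h1 : a ≤ 2 ^ (a - 1) := by
      have := Nat.lt_two_pow_self (n := a - 1)
      omega
    have h2 : 2 ^ b * a ≤ 2 ^ m :=
      (Nat.mul_le_mul_left _ h1).trans (by
        rw [← pow_add]
        exact Nat.pow_le_pow_right (by norm_num) (by omega))
    have : 0 < 2 ^ m := by positivity
    rw [pow_succ]
    omega
  calc (2 ^ a * (2 ^ b * 2 ^ b) + 1) ^ K * (2 ^ b * a + 1) ^ (2 ^ a * (2 ^ b * 2 ^ b))
      ≤ (2 ^ (2 * (m + 1))) ^ (2 ^ m) * (2 ^ (m + 1)) ^ (2 ^ (2 * m + 1)) :=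
        Nat.mul_le_mul
          ((Nat.pow_le_pow_left hT1 _).trans (Nat.pow_le_pow_right (by positivity) hK))
          ((Nat.pow_le_pow_left hM _).trans (Nat.pow_le_pow_right (by positivity) hT))
    _ = 2 ^ (2 * (m + 1) * 2 ^ m + (m + 1) * 2 ^ (2 * m + 1)) := by
        rw [← pow_mul, ← pow_mul, ← pow_add]
    _ ≤ 2 ^ 2 ^ (3 * (m + 1) - 1) := by
        apply Nat.pow_le_pow_right (by norm_num)
        -- With u = 2^m ≥ m + 1, the exponent 2(m + 1)u + 2(m + 1)u² is at most 2u² + 2u³ ≤ 4u³ =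
        -- 2^(3m + 2).
        have h1 : m + 1 ≤ 2 ^ m := Nat.lt_two_pow_self
        have h2 : 3 * (m + 1) - 1 = m + m + m + 2 := by omega
        rw [h2, show 2 * m + 1 = m + m + 1 by ring]
        simp only [pow_add]
        generalize 2 ^ m = u at *
        have h3 : (m + 1) * u ≤ u * u := Nat.mul_le_mul_right _ h1
        have h4 : (m + 1) * (u * u) ≤ u * (u * u) := Nat.mul_le_mul_right _ h1
        have h5 : u * u ≤ u * (u * u) := Nat.le_mul_of_pos_left _ (by omega)
        nlinarith

/-- Small model property of interval structures. -/
theorem IsIntervalStructure.exists_small [Fintype α] [Nonempty α] [Fintype β]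
    (H : IsIntervalStructure oL oR ok N L tl tr) {K n : ℕ}
    (hK : ∀ l r b d d', K ≤ d → K ≤ d' → ok l r b d → ok l r b d')
    (hn : Fintype.card α + Fintype.card β ≤ n) (hKn : K ≤ 2 ^ (n - 1)) :
    ∃ (N' : ℕ) (L' : ℕ → ℕ → A) (tl' : ℕ → Set α) (tr' : ℕ → Set β),
      IsIntervalStructure oL oR ok N' L' tl' tr' ∧ N' ≤ 2 ^ 2 ^ (3 * n - 1) ∧
      ∀ y < N, ∃ y' < N', tl' y' = tl y := by
  induction N using Nat.strong_induction_on generalizing L tl tr with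
  | _ N ih =>
    by_cases hN : N ≤ 2 ^ 2 ^ (3 * n - 1)
    · exact ⟨N, L, tl, tr, H, hN, fun y hy => ⟨y, hy, rfl⟩⟩
    classical
    let st := rowState K (2 ^ Fintype.card β * Fintype.card α) oR L tl tr
    have hcard := card_rowStates α β hn hKn
    rw [Nat.card_eq_fintype_card] at hcard
    obtain ⟨c, hc, d, hd, hcd, hst⟩ := Finset.exists_ne_map_eq_of_card_lt_of_maps_to
      (s := Finset.range N) (t := Finset.univ) (f := st)
      (by rw [Finset.card_univ, Finset.card_range]; omega) (fun _ _ => Finset.mem_univ _)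
    wlog hlt : c < d generalizing c d
    · exact this d hd c hc hcd.symm hst.symm (by omega)
    obtain ⟨s, rfl⟩ : ∃ s, d = c + s := ⟨d - c, by omega⟩
    have hdN := Finset.mem_range.1 hd
    obtain ⟨L₁, H₁⟩ := H.contract_of_rowState_eq hK hdN hst
    obtain ⟨N', L', tl', tr', H', hN', ht⟩ := ih (N - s) (by omega) H₁
    refine ⟨N', L', tl', tr', H', hN', fun y hy => ?_⟩
    -- Removed points lose no left observation set: row `c` shows every type that row `c + s` shows.
    have h1 : ∃ z < N - s, tl (skip c s z) = tl y := by
      by_cases hyc : y ≤ c + s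
      · obtain ⟨z, hz, hzt⟩ := exists_pointType_eq hst
          (Nat.mul_pos (by positivity) Fintype.card_pos) hyc
        exact ⟨z, by omega, by rw [skip, if_pos hz]; exact congrArg Prod.fst hzt⟩
      · exact ⟨y - s, by omega, by
          rw [skip, if_neg (by omega), Nat.sub_add_cancel (by omega)]⟩
    obtain ⟨z, hz, hzy⟩ := h1
    obtain ⟨y', hy', h2⟩ := ht z hz
    exact ⟨y', hy', h2.trans hzy⟩

end


/-! ### Closure, metric parameters and number of modalities -/

namespace Formula

variable {AP : Type*}

lemma self_mem_subformulas (φ : Formula AP) : φ ∈ subformulas φ := by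
  cases φ <;> simp [subformulas]

lemma subformulas_trans {α β φ : Formula AP} (h : α ∈ subformulas β) (h' : β ∈ subformulas φ) :
    α ∈ subformulas φ := by
  induction φ with
  | len k =>
    simp only [subformulas, Set.mem_singleton_iff] at h'
    exact h' ▸ h
  | prop p =>
    simp only [subformulas, Set.mem_singleton_iff] at h'
    exact h' ▸ h
  | or γ δ ihγ ihδ =>
    rcases h' with (h' | h') | h'
    · rwa [Set.mem_singleton_iff.1 h'] at h
    · exact Or.inl (Or.inr (ihγ h'))
    · exact Or.inr (ihδ h')
  | neg γ ih | diaL γ ih | diaR γ ih =>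
    rcases h' with h' | h'
    · rwa [Set.mem_singleton_iff.1 h'] at h
    · exact Or.inr (ih h')

lemma subformulas_subset_closure (φ : Formula AP) : subformulas φ ⊆ closure φ :=
  Set.subset_union_left

lemma mem_subformulas_of_neg {α φ : Formula AP} (h : neg α ∈ subformulas φ) :
    α ∈ subformulas φ :=
  subformulas_trans (β := neg α) (Or.inr (self_mem_subformulas α)) h

lemma self_mem_closure (φ : Formula AP) : φ ∈ closure φ :=
  subformulas_subset_closure φ (self_mem_subformulas φ)

/-- Formulae of the closure other than negations are subformulae. -/
lemma mem_subformulas_of_mem_closure {α φ : Formula AP} (h : α ∈ closure φ)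
    (hα : ∀ β, α ≠ neg β) : α ∈ subformulas φ := by
  rcases h with h | ⟨β, h, rfl⟩
  · exact h
  · cases β with
    | neg γ => exact mem_subformulas_of_neg h
    | _ => exact absurd rfl (hα _)

lemma compl_mem_closure {α φ : Formula AP} (h : α ∈ closure φ) : compl α ∈ closure φ := by
  rcases h with h | ⟨β, h, rfl⟩
  · exact Or.inr ⟨α, h, rfl⟩
  · cases β with
    | neg γ => exact Or.inr ⟨γ, mem_subformulas_of_neg h, rfl⟩
    | _ => exact Or.inl h

lemma mem_subformulas_of_neg_mem_closure {α φ : Formula AP} (h : neg α ∈ closure φ) :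
    α ∈ subformulas φ := by
  rcases h with h | ⟨β, h, hβ⟩
  · exact mem_subformulas_of_neg h
  · cases β with
    | neg γ =>
      simp only [compl] at hβ
      subst hβ
      exact mem_subformulas_of_neg (mem_subformulas_of_neg h)
    | _ =>
      simp only [compl, neg.injEq] at hβ
      exact hβ ▸ h

lemma or_mem_closure {α β φ : Formula AP} (h : or α β ∈ closure φ) :
    α ∈ closure φ ∧ β ∈ closure φ := by
  have h' := mem_subformulas_of_mem_closure h (by simp)
  exact ⟨Or.inl (subformulas_trans (β := or α β) (Or.inl (Or.inr (self_mem_subformulas α))) h'),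
    Or.inl (subformulas_trans (β := or α β) (Or.inr (self_mem_subformulas β)) h')⟩

lemma mem_closure_of_diaL {α φ : Formula AP} (h : diaL α ∈ closure φ) : α ∈ closure φ :=
  Or.inl (subformulas_trans (β := diaL α) (Or.inr (self_mem_subformulas α))
    (mem_subformulas_of_mem_closure h (by simp)))

lemma mem_closure_of_diaR {α φ : Formula AP} (h : diaR α ∈ closure φ) : α ∈ closure φ :=
  Or.inl (subformulas_trans (β := diaR α) (Or.inr (self_mem_subformulas α))
    (mem_subformulas_of_mem_closure h (by simp)))

/-- The constraint symbol itself costs one, so a numeral has at most |φ| - 1 binary digits. This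
supplies the threshold K beyond which lengths are indistinguishable. -/
lemma lt_of_len_mem_subformulas {k : ℕ} {φ : Formula AP} (h : len k ∈ subformulas φ) :
    k < 2 ^ (length φ - 1) := by
  have mono : ∀ {a b : ℕ}, a ≤ b → k < 2 ^ a → k < 2 ^ b := fun hab hk =>
    hk.trans_le (Nat.pow_le_pow_right (by norm_num) hab)
  induction φ with
  | len j =>
    simp only [subformulas, Set.mem_singleton_iff, len.injEq] at h
    subst h
    refine mono ?_ (Nat.lt_size_self k)
    simp [length, binaryDigits]
  | prop p => simp [subformulas] at h
  | or γ δ ihγ ihδ =>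
    rcases h with (h | h) | h
    · simp at h
    · exact mono (by simp only [length]; omega) (ihγ h)
    · exact mono (by simp only [length]; omega) (ihδ h)
  | neg γ ih | diaL γ ih | diaR γ ih =>
    rcases h with h | h
    · simp at h
    · exact mono (by simp only [length]; omega) (ih h)

lemma lt_of_len_mem_closure {k : ℕ} {φ : Formula AP} (h : len k ∈ closure φ) :
    k < 2 ^ (length φ - 1) :=
  lt_of_len_mem_subformulas (mem_subformulas_of_mem_closure h (by simp))

/-- A formula has fewer modalities than symbols. -/
lemma exists_finset_dia (φ : Formula AP) : ∃ s t : Finset (Formula AP),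
    (∀ ψ, diaL ψ ∈ subformulas φ → ψ ∈ s) ∧ (∀ ψ, diaR ψ ∈ subformulas φ → ψ ∈ t) ∧
    s.card + t.card + 1 ≤ length φ := by
  classical
  induction φ with
  | len k => exact ⟨∅, ∅, by simp [subformulas], by simp [subformulas], by simp [length]⟩
  | prop p => exact ⟨∅, ∅, by simp [subformulas], by simp [subformulas], by simp [length]⟩
  | neg γ ih =>
    obtain ⟨s, t, hs, ht, hst⟩ := ih
    refine ⟨s, t, fun ψ h => hs ψ ?_, fun ψ h => ht ψ ?_, by simp only [length]; omega⟩ <;>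
    simpa [subformulas] using h
  | or γ δ ihγ ihδ =>
    obtain ⟨s, t, hs, ht, hst⟩ := ihγ
    obtain ⟨s', t', hs', ht', hst'⟩ := ihδ
    refine ⟨s ∪ s', t ∪ t', fun ψ h => ?_, fun ψ h => ?_, ?_⟩
    · simp only [subformulas, Set.mem_union, Set.mem_singleton_iff, reduceCtorEq, false_or] at h
      exact Finset.mem_union.2 (h.imp (hs ψ) (hs' ψ))
    · simp only [subformulas, Set.mem_union, Set.mem_singleton_iff, reduceCtorEq, false_or] at h
      exact Finset.mem_union.2 (h.imp (ht ψ) (ht' ψ))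
    · have h1 := Finset.card_union_le s s'
      have h2 := Finset.card_union_le t t'
      simp only [length]
      omega
  | diaL γ ih =>
    obtain ⟨s, t, hs, ht, hst⟩ := ih
    refine ⟨insert γ s, t, fun ψ h => ?_, fun ψ h => ht ψ ?_, ?_⟩
    · simp only [subformulas, Set.mem_union, Set.mem_singleton_iff, diaL.injEq] at h
      exact Finset.mem_insert.2 (h.imp_right (hs ψ))
    · simpa [subformulas] using h
    · have := Finset.card_insert_le γ s
      simp only [length]
      omega
  | diaR γ ih =>
    obtain ⟨s, t, hs, ht, hst⟩ := ih
    refine ⟨s, insert γ t, fun ψ h => hs ψ ?_, fun ψ h => ?_, ?_⟩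
    · simpa [subformulas] using h
    · simp only [subformulas, Set.mem_union, Set.mem_singleton_iff, diaR.injEq] at h
      exact Finset.mem_insert.2 (h.imp_right (ht ψ))
    · have := Finset.card_insert_le γ t
      simp only [length]
      omega

end Formula

/-! ### Compass structures and models as interval structures -/

open Formula

variable {AP : Type*}

/-- There is a fulfilling structure over `N` points featuring `φ`, whose labels are atoms that
satisfy `good` with respect to the length of the interval. -/
def HasGoodCompass (φ : Formula AP) (good : Set (Formula AP) → ℕ → Prop) (N : ℕ) : Prop :=
  ∃ L : ℕ → ℕ → Set (Formula AP),
    (∀ x y, x ≤ y → y < N → IsAtom φ (L x y) ∧ good (L x y) (y - x)) ∧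
    (∀ x y z, x ≤ y → y ≤ z → z < N → DepR φ (L x y) (L y z)) ∧
    IsFulfilling φ N L ∧ Features N L φ

/-- Fulfilment gives one direction, temporal consistency the other. The right side depends on `y`
only, so all intervals ending at `y` share their right requests. -/
lemma IsFulfilling.diaR_mem_iff {φ : Formula AP} {N : ℕ} {L : ℕ → ℕ → Set (Formula AP)}
    (hdep : ∀ x y z, x ≤ y → y ≤ z → z < N → DepR φ (L x y) (L y z))
    (hful : IsFulfilling φ N L) {ψ : Formula AP} (hψ : diaR ψ ∈ closure φ) {x y : ℕ}
    (hxy : x ≤ y) (hy : y < N) :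
    diaR ψ ∈ L x y ↔ ∃ z, y ≤ z ∧ z < N ∧ ψ ∈ L y z := by
  constructor
  · intro h
    obtain ⟨x', z, h1, h2, rfl, h3⟩ := (hful x y hxy hy).1 ψ ⟨mem_closure_of_diaR hψ, h⟩
    exact ⟨z, h1, h2, h3⟩
  · rintro ⟨z, h1, h2, h3⟩
    exact ((hdep x y z hxy h1 h2).1 ⟨h3, hψ⟩).2

lemma IsFulfilling.diaL_mem_iff {φ : Formula AP} {N : ℕ} {L : ℕ → ℕ → Set (Formula AP)}
    (hdep : ∀ x y z, x ≤ y → y ≤ z → z < N → DepR φ (L x y) (L y z))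
    (hful : IsFulfilling φ N L) {ψ : Formula AP} (hψ : diaL ψ ∈ closure φ) {x y : ℕ}
    (hxy : x ≤ y) (hy : y < N) :
    diaL ψ ∈ L x y ↔ ∃ z ≤ x, ψ ∈ L z x := by
  constructor
  · intro h
    obtain ⟨z, x', h1, h2, rfl, h3⟩ := (hful x y hxy hy).2 ψ ⟨mem_closure_of_diaL hψ, h⟩
    exact ⟨z, h1, h3⟩
  · rintro ⟨z, h1, h3⟩
    exact ((hdep z x y h1 hxy hy).2 ⟨h3, hψ⟩).2

/-- The formulae, and the marker `none` of `φ`, that a label shows to the right end point. -/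
def leftObs (φ : Formula AP) (F : Set (Formula AP)) :
    Set (Option {ψ : Formula AP // diaL ψ ∈ closure φ}) :=
  {o | o.elim φ (fun ψ => ψ.1) ∈ F}

/-- The formulae that a label shows to the left end point. -/
def rightObs (φ : Formula AP) (F : Set (Formula AP)) :
    Set {ψ : Formula AP // diaR ψ ∈ closure φ} :=
  {ψ | ψ.1 ∈ F}

/-- The labels allowed on an interval of length `d`. -/
def Allowed (φ : Formula AP) (good : Set (Formula AP) → ℕ → Prop)
    (l : Set (Option {ψ : Formula AP // diaL ψ ∈ closure φ}))
    (r : Set {ψ : Formula AP // diaR ψ ∈ closure φ}) (F : Set (Formula AP)) (d : ℕ) : Prop :=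
  IsAtom φ F ∧ (∀ ψ : {ψ : Formula AP // diaL ψ ∈ closure φ}, diaL ψ.1 ∈ F ↔ some ψ ∈ l) ∧
    (∀ ψ : {ψ : Formula AP // diaR ψ ∈ closure φ}, diaR ψ.1 ∈ F ↔ ψ ∈ r) ∧ good F d

lemma HasGoodCompass.exists_isIntervalStructure {φ : Formula AP}
    {good : Set (Formula AP) → ℕ → Prop} {N : ℕ} (h : HasGoodCompass φ good N) :
    ∃ L tl tr, IsIntervalStructure (leftObs φ) (rightObs φ) (Allowed φ good) N L tl tr ∧
      ∃ y < N, none ∈ tl y := by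
  obtain ⟨L, hat, hdep, hful, x₀, y₀, hxy₀, hy₀, hφ⟩ := h
  refine ⟨L, fun y => {ψ | ∃ x ≤ y, ψ ∈ leftObs φ (L x y)},
    fun x => {ψ | ∃ y, x ≤ y ∧ y < N ∧ ψ ∈ rightObs φ (L x y)},
    ⟨fun x y hxy hy => ⟨(hat x y hxy hy).1, fun ψ => ?_, fun ψ => ?_, (hat x y hxy hy).2⟩,
      fun _ _ _ => Iff.rfl, fun _ _ _ => Iff.rfl⟩, y₀, hy₀, x₀, hxy₀, hφ⟩
  · exact IsFulfilling.diaL_mem_iff hdep hful ψ.2 hxy hy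
  · exact IsFulfilling.diaR_mem_iff hdep hful ψ.2 hxy hy

/-- All labels around a point refer through `Allowed` to the same observation sets, which gives
consistency; each observation has a witness, which gives fulfilment. The marker `none` is an
observation of `φ` itself. -/
lemma IsIntervalStructure.hasGoodCompass {φ : Formula AP}
    {good : Set (Formula AP) → ℕ → Prop} {N : ℕ} {L : ℕ → ℕ → Set (Formula AP)}
    {tl : ℕ → Set (Option {ψ : Formula AP // diaL ψ ∈ closure φ})}
    {tr : ℕ → Set {ψ : Formula AP // diaR ψ ∈ closure φ}}
    (H : IsIntervalStructure (leftObs φ) (rightObs φ) (Allowed φ good) N L tl tr)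
    (hφ : ∃ y < N, none ∈ tl y) : HasGoodCompass φ good N := by
  refine ⟨L, fun x y hxy hy => ⟨(H.ok x y hxy hy).1, (H.ok x y hxy hy).2.2.2⟩, ?_, ?_, ?_⟩
  · intro x y z hxy hyz hz
    have h1 := H.ok x y hxy (by omega)
    have h2 := H.ok y z hyz hz
    refine ⟨fun ψ hψ => ⟨mem_closure_of_diaR hψ.2, ?_⟩, fun ψ hψ => ⟨mem_closure_of_diaL hψ.2, ?_⟩⟩
    · exact (h1.2.2.1 ⟨ψ, hψ.2⟩).2 ((H.right y (by omega) _).2 ⟨z, hyz, hz, hψ.1⟩)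
    · exact (h2.2.1 ⟨ψ, hψ.2⟩).2 ((H.left y (by omega) _).2 ⟨x, hxy, hψ.1⟩)
  · intro x y hxy hy
    have h1 := H.ok x y hxy hy
    refine ⟨fun ψ hψ => ?_, fun ψ hψ => ?_⟩
    · obtain ⟨z, hz, hzN, h2⟩ :=
        (H.right y hy _).1 ((h1.2.2.1 ⟨ψ, h1.1.subset hψ.2⟩).1 hψ.2)
      exact ⟨y, z, hz, hzN, rfl, h2⟩
    · obtain ⟨z, hz, h2⟩ :=
        (H.left x (by omega) _).1 ((h1.2.1 ⟨ψ, h1.1.subset hψ.2⟩).1 hψ.2)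
      exact ⟨z, x, hz, by omega, rfl, h2⟩
  · obtain ⟨y, hy, h1⟩ := hφ
    obtain ⟨x, hx, h2⟩ := (H.left y hy _).1 h1
    exact ⟨x, y, hx, hy, h2⟩

/-- Small model property for fulfilling structures with a length condition that does not
distinguish large lengths. -/
theorem HasGoodCompass.exists_small {φ : Formula AP} {good : Set (Formula AP) → ℕ → Prop}
    (hgood : ∀ F d d', IsAtom φ F → 2 ^ (length φ - 1) ≤ d → 2 ^ (length φ - 1) ≤ d' →
      good F d → good F d') {N : ℕ} (h : HasGoodCompass φ good N) :
    ∃ N', HasGoodCompass φ good N' ∧ N' ≤ 2 ^ 2 ^ (3 * length φ - 1) := by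
  classical
  obtain ⟨s, t, hs, ht, hst⟩ := exists_finset_dia φ
  let f : {ψ : Formula AP // diaL ψ ∈ closure φ} → s :=
    fun ψ => ⟨ψ.1, hs _ (mem_subformulas_of_mem_closure ψ.2 (by simp))⟩
  let g : {ψ : Formula AP // diaR ψ ∈ closure φ} → t :=
    fun ψ => ⟨ψ.1, ht _ (mem_subformulas_of_mem_closure ψ.2 (by simp))⟩
  have hf : f.Injective := fun a b hab => Subtype.ext (congrArg (fun c => c.1) hab)
  have hg : g.Injective := fun a b hab => Subtype.ext (congrArg (fun c => c.1) hab)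
  let _ := Fintype.ofInjective f hf
  let _ := Fintype.ofInjective g hg
  have hf' := Fintype.card_le_of_injective f hf
  have hg' := Fintype.card_le_of_injective g hg
  rw [Fintype.card_coe] at hf' hg'
  obtain ⟨L, tl, tr, H, y, hy, hφ⟩ := h.exists_isIntervalStructure
  -- The marker `none` adds one to the number of modalities, and the total is still at most |φ|.
  obtain ⟨N', L', tl', tr', H', hN', hty⟩ := H.exists_small
    (fun l r F d d' hd hd' hF =>
      (⟨hF.1, hF.2.1, hF.2.2.1, hgood F d d' hF.1 hd hd' hF.2.2.2⟩ : Allowed φ good l r F d'))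
    (n := length φ) (by rw [Fintype.card_option]; omega) le_rfl
  obtain ⟨y', hy', hyy⟩ := hty y hy
  exact ⟨N', H'.hasGoodCompass ⟨y', hy', hyy ▸ hφ⟩, hN'⟩

/-- The length condition is one-sided: a label may lack a length constraint that is true of its
interval. Models need the two-sided condition, hence the parameter `good`. -/
lemma hasFulfillingCompass_iff {φ : Formula AP} {N : ℕ} : HasFulfillingCompass φ N ↔
    HasGoodCompass φ (fun F d => ∀ k, len k ∈ F → d < k) N := by
  constructor
  · rintro ⟨L, h, hful, hfeat⟩
    exact ⟨L, fun x y hxy hy => ⟨h.atom x y hxy hy, h.length_consistency x y hxy hy⟩,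
      fun x y z hxy hyz hz => h.temporal_consistency x y y z hxy (by omega) hyz hz rfl, hful, hfeat⟩
  · rintro ⟨L, hat, hdep, hful, hfeat⟩
    refine ⟨L, ⟨fun x y hxy hy => (hat x y hxy hy).1, ?_,
      fun x y hxy hy => (hat x y hxy hy).2⟩, hful, hfeat⟩
    rintro x y x' y' hxy hy hxy' hy' rfl
    exact hdep x y y' hxy hxy' hy'

lemma holds_compl (N : ℕ) (V : AP → ℕ → ℕ → Prop) (x y : ℕ) (α : Formula AP) :
    Holds N V x y (compl α) ↔ ¬ Holds N V x y α := by
  cases α <;> simp [Formula.compl, Holds]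

lemma isAtom_holds (φ : Formula AP) (N : ℕ) (V : AP → ℕ → ℕ → Prop) (x y : ℕ) :
    IsAtom φ {α | α ∈ closure φ ∧ Holds N V x y α} where
  nonempty := by
    by_cases h : Holds N V x y φ
    · exact ⟨φ, self_mem_closure φ, h⟩
    · exact ⟨compl φ, compl_mem_closure (self_mem_closure φ), (holds_compl N V x y φ).2 h⟩
  subset := fun _ h => h.1
  neg_iff := fun α hα => by
    simp [hα, compl_mem_closure hα, holds_compl]
  or_iff := fun α β h => by
    simp [h, or_mem_closure h, Holds]
  len_mono := fun k _ k' hk' hkk h => ⟨hk', lt_trans h.2 hkk⟩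

/-- Models correspond to structures in which length constraints are interpreted exactly. -/
lemma satisfiableOn_iff {φ : Formula AP} {N : ℕ} : SatisfiableOn N φ ↔
    HasGoodCompass φ (fun F d => ∀ k, len k ∈ closure φ → (len k ∈ F ↔ d < k)) N := by
  constructor
  · rintro ⟨V, x₀, y₀, hxy₀, hy₀, hφ⟩
    refine ⟨fun x y => {α | α ∈ closure φ ∧ Holds N V x y α}, fun x y hxy hy =>
      ⟨isAtom_holds φ N V x y, fun k hk => ?_⟩, fun x y z hxy hyz hz => ⟨fun ψ hψ => ?_,
      fun ψ hψ => ?_⟩, fun x y hxy hy => ⟨fun ψ hψ => ?_, fun ψ hψ => ?_⟩,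
      x₀, y₀, hxy₀, hy₀, self_mem_closure φ, hφ⟩
    · simp [hk, Holds]
    · exact ⟨hψ.1.1, hψ.2, z, hyz, hz, hψ.1.2⟩
    · exact ⟨hψ.1.1, hψ.2, x, hxy, hψ.1.2⟩
    · obtain ⟨z, h1, h2, h3⟩ := hψ.2.2
      exact ⟨y, z, h1, h2, rfl, hψ.1, h3⟩
    · obtain ⟨z, h1, h3⟩ := hψ.2.2
      exact ⟨z, x, h1, by omega, rfl, hψ.1, h3⟩
  · rintro ⟨L, hat, hdep, hful, x₀, y₀, hxy₀, hy₀, hφ⟩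
    refine ⟨fun p x y => prop p ∈ L x y, x₀, y₀, hxy₀, hy₀, ?_⟩
    have truth : ∀ α ∈ closure φ, ∀ x y, x ≤ y → y < N →
        (Holds N (fun p x y => prop p ∈ L x y) x y α ↔ α ∈ L x y) := by
      intro α
      induction α with
      | len k => exact fun hα x y hxy hy => ((hat x y hxy hy).2 k hα).symm
      | prop p => exact fun _ _ _ _ _ => Iff.rfl
      | neg β ih =>
        intro hα x y hxy hy
        rw [(hat x y hxy hy).1.neg_iff _ hα, Holds,
          ih (Or.inl (mem_subformulas_of_neg_mem_closure hα)) x y hxy hy]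
        rfl
      | or β γ ihβ ihγ =>
        intro hα x y hxy hy
        rw [(hat x y hxy hy).1.or_iff _ _ hα, Holds, ihβ (or_mem_closure hα).1 x y hxy hy,
          ihγ (or_mem_closure hα).2 x y hxy hy]
      | diaL β ih =>
        intro hα x y hxy hy
        rw [IsFulfilling.diaL_mem_iff hdep hful hα hxy hy, Holds]
        refine exists_congr fun z => and_congr_right fun hz => ?_
        exact ih (mem_closure_of_diaL hα) z x hz (by omega)
      | diaR β ih =>
        intro hα x y hxy hy
        rw [IsFulfilling.diaR_mem_iff hdep hful hα hxy hy,
          Holds]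
        refine exists_congr fun z => and_congr_right fun hz => and_congr_right fun hzN => ?_
        exact ih (mem_closure_of_diaR hα) y z hz hzN
    exact (truth φ (self_mem_closure φ) x₀ y₀ hxy₀ hy₀).2 hφ

/-! ### Comparison with the bound B(φ) -/

lemma one_le_length (φ : Formula AP) : 1 ≤ length φ := by
  cases φ <;> simp only [length] <;> omega

lemma cast_le_bound {n N : ℕ} (hn : 1 ≤ n) (hN : N ≤ 2 ^ 2 ^ (3 * n - 1)) :
    (N : ℝ) ≤ ((n : ℝ) ^ 2 / 4 + (n : ℝ) / 2 + 1) ^ (2 ^ (3 * n)) := by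
  have hn' : (1 : ℝ) ≤ n := by exact_mod_cast hn
  -- For n = 1 the base is only 7/4, but its square exceeds 2; the square is paid for by the spare
  -- factor 2 in the exponent.
  have h2 : (2 : ℝ) ≤ ((n : ℝ) ^ 2 / 4 + (n : ℝ) / 2 + 1) ^ 2 := by nlinarith [sq_nonneg (n : ℝ)]
  have hexp : 2 ^ (3 * n) = 2 * 2 ^ (3 * n - 1) := by
    rw [← pow_succ', Nat.sub_add_cancel (by omega)]
  calc (N : ℝ) ≤ 2 ^ 2 ^ (3 * n - 1) := by exact_mod_cast hN
    _ ≤ (((n : ℝ) ^ 2 / 4 + (n : ℝ) / 2 + 1) ^ 2) ^ 2 ^ (3 * n - 1) :=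
        pow_le_pow_left₀ (by norm_num) h2 _
    _ = _ := by rw [← pow_mul, ← hexp]

end MPNL

theorem mainTheorem4 {AP : Type*} (φ : MPNL.Formula AP) :
    ((∃ N : ℕ, MPNL.HasFulfillingCompass φ N) →
      ∃ N' : ℕ, MPNL.HasFulfillingCompass φ N' ∧
        (N' : ℝ) ≤ ((φ.length : ℝ) ^ 2 / 4 + (φ.length : ℝ) / 2 + 1) ^ (2 ^ (3 * φ.length))) ∧
    ((∃ N : ℕ, MPNL.SatisfiableOn N φ) →
      ∃ N' : ℕ, MPNL.SatisfiableOn N' φ ∧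
        (N' : ℝ) ≤ ((φ.length : ℝ) ^ 2 / 4 + (φ.length : ℝ) / 2 + 1) ^ (2 ^ (3 * φ.length))) := by
  constructor
  · rintro ⟨N, h⟩
    obtain ⟨N', h', hN'⟩ := (MPNL.hasFulfillingCompass_iff.1 h).exists_small
      (fun F d d' hF hd _ hG k hk => by
        -- At length `d ≥ K > k` the label cannot contain `len k`, so the condition at `d'` is
        -- vacuous.
        have h1 := hG k hk
        have h2 := MPNL.Formula.lt_of_len_mem_closure (hF.subset hk)
        omega)
    exact ⟨N', MPNL.hasFulfillingCompass_iff.2 h',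
      MPNL.cast_le_bound (MPNL.one_le_length φ) hN'⟩
  · rintro ⟨N, h⟩
    obtain ⟨N', h', hN'⟩ := (MPNL.satisfiableOn_iff.1 h).exists_small
      (fun F d d' _ hd hd' hG k hk => by
        -- Both `d` and `d'` exceed every parameter `k`, so `len k` is false at both lengths.
        have h2 := MPNL.Formula.lt_of_len_mem_closure hk
        rw [hG k hk]
        omega)
    exact ⟨N', MPNL.satisfiableOn_iff.2 h', MPNL.cast_le_bound (MPNL.one_le_length φ) hN'⟩
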